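/- **Proposition 3.4.** Let $A$ be a separable unital $C^*$-algebra, let $C$ be a unital $C^*$-algebra, let $G$ be a normal subgroup of the unitary group $U(C)$, and let $h_1, h_2 : A \to C$ be injective $*$-homomorphisms such that $h_1(1_A) = 1_C$ and $h_2 = \mathrm{ad}\,u \circ h_1$ for some $u \in U(C)$, where $\mathrm{ad}\,u(x) = u^* x u$. Suppose that $h_1$ and $h_2$ are $G$-strongly unitarily equivalent, i.e. there is $w \in G$ with $\mathrm{ad}\,w(h_1(a)) = h_2(a)$ for all $a \in A$. Then $$[u] \in H_1(K_0(A), K_1(C)) + \overline{G} \subseteq K_1(C),$$ where $\overline{G} = \{[g] : g \in G\}$ is the image of $G$ in $K_1(C)$ and $$H_1(K_0(A), K_1(C)) = \{\phi([1_A]) : \phi \in \mathrm{Hom}(K_0(A), K_1(C))\}.$$ -/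

import Mathlib

open scoped Matrix Pointwise

namespace CStarKTheory

universe u v

noncomputable section

/-! ## Murray-von Neumann equivalence and `K₀` of a unital C⋆-algebra -/

section KZero

variable {A : Type u} [CStarAlgebra A]
variable {ι κ μ ι' κ' : Type*} [Fintype ι] [Fintype κ] [Fintype μ] [Fintype ι'] [Fintype κ']

/-- Murray-von Neumann equivalence of square matrices `p`, `q` over `A`, possibly of different
sizes: there is a rectangular matrix `v` over `A` with `v⋆v = p` and `vv⋆ = q`. -/
def MvN (p : Matrix ι ι A) (q : Matrix κ κ A) : Prop :=
  ∃ v : Matrix κ ι A, vᴴ * v = p ∧ v * vᴴ = q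

lemma MvN.refl {p : Matrix ι ι A} (hp : IsStarProjection p) : MvN p p := by
  have h1 : pᴴ = p := hp.isSelfAdjoint
  have h2 : p * p = p := hp.isIdempotentElem
  exact ⟨p, by rw [h1, h2], by rw [h1, h2]⟩

lemma MvN.symm {p : Matrix ι ι A} {q : Matrix κ κ A} (h : MvN p q) : MvN q p := by
  obtain ⟨v, h1, h2⟩ := h
  exact ⟨vᴴ, by rw [Matrix.conjTranspose_conjTranspose, h2],
    by rw [Matrix.conjTranspose_conjTranspose, h1]⟩

lemma MvN.trans {p : Matrix ι ι A} {q : Matrix κ κ A} {r : Matrix μ μ A}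
    (hp : IsStarProjection p) (hr : IsStarProjection r) (h : MvN p q) (h' : MvN q r) :
    MvN p r := by
  obtain ⟨v, rfl, h2⟩ := h
  obtain ⟨w, h3, rfl⟩ := h'
  have hp2 : vᴴ * v * (vᴴ * v) = vᴴ * v := hp.isIdempotentElem
  have hr2 : w * wᴴ * (w * wᴴ) = w * wᴴ := hr.isIdempotentElem
  refine ⟨w * v, ?_, ?_⟩
  · rw [Matrix.conjTranspose_mul, Matrix.mul_assoc, ← Matrix.mul_assoc wᴴ, h3, ← h2, ← hp2]
    simp only [Matrix.mul_assoc]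
  · rw [Matrix.conjTranspose_mul, Matrix.mul_assoc, ← Matrix.mul_assoc v, h2, ← h3, ← hr2]
    simp only [Matrix.mul_assoc]

lemma MvN.reindex (e : ι ≃ κ) {p : Matrix ι ι A} (hp : IsStarProjection p) :
    MvN p (Matrix.reindex e e p) := by
  have h1 : pᴴ = p := hp.isSelfAdjoint
  have h2 : p * p = p := hp.isIdempotentElem
  refine ⟨p.submatrix e.symm id, ?_, ?_⟩
  · rw [Matrix.conjTranspose_submatrix, h1, Matrix.submatrix_mul_equiv, h2]
    rfl
  · rw [Matrix.conjTranspose_submatrix, h1]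
    have := Matrix.submatrix_mul_equiv p p e.symm (Equiv.refl ι) e.symm
    rw [h2] at this
    exact this

lemma MvN.fromBlocks {p : Matrix ι ι A} {q : Matrix κ κ A} {p' : Matrix ι' ι' A}
    {q' : Matrix κ' κ' A} (h : MvN p p') (h' : MvN q q') :
    MvN (Matrix.fromBlocks p 0 0 q) (Matrix.fromBlocks p' 0 0 q') := by
  obtain ⟨v, rfl, rfl⟩ := h
  obtain ⟨w, rfl, rfl⟩ := h'
  exact ⟨Matrix.fromBlocks v 0 0 w, by simp [Matrix.fromBlocks_conjTranspose,
    Matrix.fromBlocks_multiply], by simp [Matrix.fromBlocks_conjTranspose,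
    Matrix.fromBlocks_multiply]⟩

lemma isStarProjection_fromBlocks {p : Matrix ι ι A} {q : Matrix κ κ A}
    (hp : IsStarProjection p) (hq : IsStarProjection q) :
    IsStarProjection (Matrix.fromBlocks p 0 0 q) := by
  have h1 : pᴴ = p := hp.isSelfAdjoint
  have h2 : p * p = p := hp.isIdempotentElem
  have h3 : qᴴ = q := hq.isSelfAdjoint
  have h4 : q * q = q := hq.isIdempotentElem
  refine ⟨?_, ?_⟩
  · simp [IsIdempotentElem, Matrix.fromBlocks_multiply, h2, h4]
  · rw [IsSelfAdjoint, Matrix.star_eq_conjTranspose]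
    simp [Matrix.fromBlocks_conjTranspose, h1, h3]

lemma isStarProjection_reindex (e : ι ≃ κ) {p : Matrix ι ι A} (hp : IsStarProjection p) :
    IsStarProjection (Matrix.reindex e e p) := by
  have h1 : pᴴ = p := hp.isSelfAdjoint
  have h2 : p * p = p := hp.isIdempotentElem
  refine ⟨?_, ?_⟩
  · simp only [IsIdempotentElem, Matrix.reindex_apply, Matrix.submatrix_mul_equiv, h2]
  · rw [IsSelfAdjoint, Matrix.star_eq_conjTranspose, Matrix.conjTranspose_reindex, h1]

variable (A) in
/-- Projections (self-adjoint idempotents) in the matrix algebras `M_n(A)`, `n = 0, 1, 2, …`. -/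
abbrev MatProj : Type u := Σ n : ℕ, {p : Matrix (Fin n) (Fin n) A // IsStarProjection p}

variable (A) in
/-- Murray-von Neumann equivalence on the projections in matrix algebras over `A`. -/
instance matProjSetoid : Setoid (MatProj A) where
  r p q := MvN p.2.1 q.2.1
  iseqv :=
    ⟨fun p => MvN.refl p.2.2, fun h => h.symm, fun {p _ r} h h' => h.trans p.2.2 r.2.2 h'⟩

/-- The block-diagonal sum `diag(p, q)` of matrices of sizes `m` and `n`. -/
def blockSum {m n : ℕ} (p : Matrix (Fin m) (Fin m) A) (q : Matrix (Fin n) (Fin n) A) :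
    Matrix (Fin (m + n)) (Fin (m + n)) A :=
  Matrix.reindex finSumFinEquiv finSumFinEquiv (Matrix.fromBlocks p 0 0 q)

/-- The block-diagonal sum of two projections. -/
def MatProj.sum (p q : MatProj A) : MatProj A :=
  ⟨p.1 + q.1, blockSum p.2.1 q.2.1,
    isStarProjection_reindex _ (isStarProjection_fromBlocks p.2.2 q.2.2)⟩

lemma MatProj.sum_mvN (p q : MatProj A) :
    MvN (p.sum q).2.1 (Matrix.fromBlocks p.2.1 0 0 q.2.1) :=
  (MvN.reindex _ (isStarProjection_fromBlocks p.2.2 q.2.2)).symm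

lemma MatProj.sum_congr {p p' q q' : MatProj A} (h : p ≈ p') (h' : q ≈ q') :
    p.sum q ≈ p'.sum q' := by
  have hb := isStarProjection_fromBlocks p'.2.2 q'.2.2
  exact ((MatProj.sum_mvN p q).trans (p.sum q).2.2 hb (MvN.fromBlocks h h')).trans
    (p.sum q).2.2 (p'.sum q').2.2 (MatProj.sum_mvN p' q').symm

lemma MatProj.sum_comm (p q : MatProj A) : p.sum q ≈ q.sum p := by
  have hb := isStarProjection_fromBlocks p.2.2 q.2.2
  have hb' := isStarProjection_fromBlocks q.2.2 p.2.2
  have h := MvN.reindex (Equiv.sumComm _ _) hb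
  have e : Matrix.reindex (Equiv.sumComm _ _) (Equiv.sumComm _ _)
      (Matrix.fromBlocks p.2.1 0 0 q.2.1) = Matrix.fromBlocks q.2.1 0 0 p.2.1 := by
    ext (i | i) (j | j) <;> rfl
  rw [e] at h
  exact ((MatProj.sum_mvN p q).trans (p.sum q).2.2 hb' h).trans
    (p.sum q).2.2 (q.sum p).2.2 (MatProj.sum_mvN q p).symm

lemma MatProj.sum_assoc (p q r : MatProj A) : (p.sum q).sum r ≈ p.sum (q.sum r) := by
  have b1 := isStarProjection_fromBlocks (isStarProjection_fromBlocks p.2.2 q.2.2) r.2.2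
  have b2 := isStarProjection_fromBlocks p.2.2 (isStarProjection_fromBlocks q.2.2 r.2.2)
  have h := MvN.reindex (Equiv.sumAssoc _ _ _) b1
  have e : Matrix.reindex (Equiv.sumAssoc _ _ _) (Equiv.sumAssoc _ _ _)
      (Matrix.fromBlocks (Matrix.fromBlocks p.2.1 0 0 q.2.1) 0 0 r.2.1) =
      Matrix.fromBlocks p.2.1 0 0 (Matrix.fromBlocks q.2.1 0 0 r.2.1) := by
    ext (i | i | i) (j | j | j) <;> rfl
  rw [e] at h
  have l1 : MvN ((p.sum q).sum r).2.1
      (Matrix.fromBlocks (Matrix.fromBlocks p.2.1 0 0 q.2.1) 0 0 r.2.1) :=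
    (MatProj.sum_mvN (p.sum q) r).trans ((p.sum q).sum r).2.2 b1
      (MvN.fromBlocks (MatProj.sum_mvN p q) (MvN.refl r.2.2))
  have l2 : MvN (p.sum (q.sum r)).2.1
      (Matrix.fromBlocks p.2.1 0 0 (Matrix.fromBlocks q.2.1 0 0 r.2.1)) :=
    (MatProj.sum_mvN p (q.sum r)).trans (p.sum (q.sum r)).2.2 b2
      (MvN.fromBlocks (MvN.refl p.2.2) (MatProj.sum_mvN q r))
  exact (l1.trans ((p.sum q).sum r).2.2 b2 h).trans ((p.sum q).sum r).2.2
    (p.sum (q.sum r)).2.2 l2.symm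

variable (A) in
/-- The (empty) projection in `M_0(A)`. -/
def MatProj.zero : MatProj A := ⟨0, 0, IsStarProjection.zero _⟩

lemma MatProj.zero_sum (p : MatProj A) : (MatProj.zero A).sum p ≈ p := by
  have h := MvN.reindex (Equiv.emptySum (Fin 0) (Fin p.1))
    (isStarProjection_fromBlocks (IsStarProjection.zero (Matrix (Fin 0) (Fin 0) A)) p.2.2)
  have e : Matrix.reindex (Equiv.emptySum (Fin 0) (Fin p.1)) (Equiv.emptySum (Fin 0) (Fin p.1))
      (Matrix.fromBlocks (0 : Matrix (Fin 0) (Fin 0) A) 0 0 p.2.1) = p.2.1 := by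
    ext i j; rfl
  rw [e] at h
  exact (MatProj.sum_mvN _ p).trans ((MatProj.zero A).sum p).2.2 p.2.2 h

variable (A) in
/-- The semigroup `V(A)` of Murray-von Neumann classes of projections in matrices over `A`. -/
def V : Type u := Quotient (matProjSetoid A)

/-- Addition in `V(A)`: `[p] + [q] = [diag(p, q)]`. -/
instance : Add (V A) :=
  ⟨Quotient.map₂ MatProj.sum fun _ _ h _ _ h' => MatProj.sum_congr h h'⟩

instance : Zero (V A) := ⟨Quotient.mk _ (MatProj.zero A)⟩

instance : AddCommMonoid (V A) where
  add_assoc := by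
    rintro ⟨p⟩ ⟨q⟩ ⟨r⟩
    exact Quotient.sound (MatProj.sum_assoc p q r)
  add_comm := by
    rintro ⟨p⟩ ⟨q⟩
    exact Quotient.sound (MatProj.sum_comm p q)
  zero_add := by
    rintro ⟨p⟩
    exact Quotient.sound (MatProj.zero_sum p)
  add_zero := by
    rintro ⟨p⟩
    exact Quotient.sound (Setoid.trans (MatProj.sum_comm p _) (MatProj.zero_sum p))
  nsmul := nsmulRec

/-- The class in `V(A)` of a projection in `M_n(A)`. -/
def V.mk {n : ℕ} (p : Matrix (Fin n) (Fin n) A) (hp : IsStarProjection p) : V A :=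
  Quotient.mk _ ⟨n, p, hp⟩

variable (A) in
/-- `K₀(A)` for a unital C⋆-algebra `A`: the Grothendieck group of `V(A)`. -/
abbrev K0 : Type u := Algebra.GrothendieckAddGroup (V A)

/-- The class `[p] ∈ K₀(A)` of a projection `p ∈ M_n(A)`. -/
def K0.mk {n : ℕ} (p : Matrix (Fin n) (Fin n) A) (hp : IsStarProjection p) : K0 A :=
  Algebra.GrothendieckAddGroup.of (V.mk p hp)

variable (A) in
/-- The class `[1_A] ∈ K₀(A)` of the unit of `A = M_1(A)`. -/
def K0.unitClass : K0 A := K0.mk (1 : Matrix (Fin 1) (Fin 1) A) (IsStarProjection.one _)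

end KZero

/-! ## `K₁` of a unital C⋆-algebra -/

section KOne

variable {C : Type v} [CStarAlgebra C]

variable (C) in
/-- The unitary group `U(M_n(C))`. The matrix algebra carries the topology of entrywise
convergence, which is the topology of its C⋆-norm. -/
abbrev UMat (n : ℕ) : Type v := unitary (Matrix (Fin n) (Fin n) C)

/-- The identification of `Fin n ⊕ Fin (N - n)` with `Fin N` for `n ≤ N`, the first summand
going to the first `n` indices. -/
def padEquiv {n N : ℕ} (h : n ≤ N) : Fin n ⊕ Fin (N - n) ≃ Fin N :=
  finSumFinEquiv.trans (finCongr (Nat.add_sub_of_le h))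

/-- The corner embedding `u ↦ diag(u, 1)` of unitary groups, for any splitting of the index set. -/
def corner {ι κ μ : Type*} [Fintype ι] [Fintype κ] [Fintype μ] [DecidableEq ι] [DecidableEq κ]
    [DecidableEq μ] (e : ι ⊕ κ ≃ μ) : unitary (Matrix ι ι C) →* unitary (Matrix μ μ C) where
  toFun u := ⟨Matrix.reindex e e (Matrix.fromBlocks (u : Matrix ι ι C) 0 0 1), by
    have h1 : (u : Matrix ι ι C)ᴴ * u = 1 := Unitary.coe_star_mul_self u
    have h2 : (u : Matrix ι ι C) * (u : Matrix ι ι C)ᴴ = 1 := Unitary.coe_mul_star_self u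
    rw [Unitary.mem_iff, Matrix.star_eq_conjTranspose, Matrix.conjTranspose_reindex]
    simp only [Matrix.reindex_apply, Matrix.submatrix_mul_equiv,
      Matrix.fromBlocks_conjTranspose, Matrix.fromBlocks_multiply]
    simp [h1, h2]⟩
  map_one' := by
    apply Subtype.ext
    simp
  map_mul' u v := by
    apply Subtype.ext
    simp [Matrix.submatrix_mul_equiv, Matrix.fromBlocks_multiply]

lemma continuous_corner {ι κ μ : Type*} [Fintype ι] [Fintype κ] [Fintype μ] [DecidableEq ι]
    [DecidableEq κ] [DecidableEq μ] (e : ι ⊕ κ ≃ μ) : Continuous (corner (C := C) e) := by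
  refine Continuous.subtype_mk ?_ _
  refine Continuous.matrix_reindex (Continuous.matrix_fromBlocks ?_ ?_ ?_ ?_) e e
  · exact continuous_subtype_val
  all_goals exact continuous_const

/-- The stabilization `U(M_n(C)) → U(M_N(C))`, `u ↦ diag(u, 1, …, 1)`, for `n ≤ N`. -/
def pad {n N : ℕ} (h : n ≤ N) : UMat C n →* UMat C N := corner (padEquiv h)

lemma pad_apply {n N : ℕ} (h : n ≤ N) (u : UMat C n) (i j : Fin N) :
    (pad h u : Matrix (Fin N) (Fin N) C) i j =
      if hij : (i : ℕ) < n ∧ (j : ℕ) < n then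
        (u : Matrix (Fin n) (Fin n) C) ⟨i, hij.1⟩ ⟨j, hij.2⟩
      else if i = j then 1 else 0 := by
  obtain ⟨a, rfl⟩ := (padEquiv h).surjective i
  obtain ⟨b, rfl⟩ := (padEquiv h).surjective j
  have key : (pad h u : Matrix (Fin N) (Fin N) C) (padEquiv h a) (padEquiv h b) =
      Matrix.fromBlocks (u : Matrix (Fin n) (Fin n) C) 0 0 1 a b := by
    simp [pad, corner]
  rw [key]
  rcases a with a | a <;> rcases b with b | b
  · simp [padEquiv]
  · simp [padEquiv, Fin.ext_iff]
    omega
  · simp [padEquiv, Fin.ext_iff]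
    omega
  · simp [padEquiv, Matrix.one_apply]

lemma pad_pad {m n N : ℕ} (h : m ≤ n) (h' : n ≤ N) (u : UMat C m) :
    pad h' (pad h u) = pad (h.trans h') u := by
  apply Subtype.ext
  ext i j
  simp only [pad_apply, Fin.ext_iff]
  split_ifs <;> first | rfl | omega

lemma pad_self {n : ℕ} (u : UMat C n) : pad le_rfl u = u := by
  apply Subtype.ext
  ext i j
  simp [pad_apply]

lemma joined_pad {n N : ℕ} (h : n ≤ N) {u v : UMat C n} (huv : Joined u v) :
    Joined (pad h u) (pad h v) :=
  huv.map (continuous_corner _)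

variable (C) in
/-- Unitary matrices over `C` of arbitrary size. -/
abbrev MatUnitary : Type v := Σ n : ℕ, UMat C n

variable (C) in
/-- Stable homotopy of unitary matrices: `u` and `v` are equivalent when `diag(u, 1, …, 1)` and
`diag(v, 1, …, 1)` are joined by a continuous path in some `U(M_N(C))`. -/
instance matUnitarySetoid : Setoid (MatUnitary C) where
  r u v := ∃ (N : ℕ) (hu : u.1 ≤ N) (hv : v.1 ≤ N), Joined (pad hu u.2) (pad hv v.2)
  iseqv := by
    refine ⟨fun u => ⟨u.1, le_rfl, le_rfl, Joined.refl _⟩, ?_, ?_⟩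
    · rintro u v ⟨N, hu, hv, h⟩
      exact ⟨N, hv, hu, h.symm⟩
    · rintro u v w ⟨N, hu, hv, h⟩ ⟨N', hv', hw, h'⟩
      refine ⟨max N N', hu.trans (le_max_left _ _), hw.trans (le_max_right _ _), ?_⟩
      have a := joined_pad (le_max_left N N') h
      have b := joined_pad (le_max_right N N') h'
      rw [pad_pad, pad_pad] at a b
      exact a.trans b

/-- The product of two unitary matrices after stabilizing them to a common size. -/
def MatUnitary.mul (u v : MatUnitary C) : MatUnitary C :=
  ⟨max u.1 v.1, pad (le_max_left _ _) u.2 * pad (le_max_right _ _) v.2⟩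

lemma MatUnitary.equiv_of_joined {u v : MatUnitary C} {N : ℕ} (hu : u.1 ≤ N) (hv : v.1 ≤ N)
    (h : Joined (pad hu u.2) (pad hv v.2)) : u ≈ v := ⟨N, hu, hv, h⟩

lemma MatUnitary.pad_equiv {n N : ℕ} (h : n ≤ N) (u : UMat C n) :
    (⟨N, pad h u⟩ : MatUnitary C) ≈ ⟨n, u⟩ := by
  refine MatUnitary.equiv_of_joined (N := N) le_rfl h ?_
  rw [pad_self]

lemma MatUnitary.pad_mul (u v : MatUnitary C) {N : ℕ} (h : (u.mul v).1 ≤ N) :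
    pad h (u.mul v).2 = pad ((le_max_left _ _).trans h) u.2 *
      pad ((le_max_right _ _).trans h) v.2 := by
  have h' : max u.1 v.1 ≤ N := h
  change pad h' (pad _ u.2 * pad _ v.2) = _
  rw [map_mul, pad_pad, pad_pad]

lemma MatUnitary.mul_congr {u u' v v' : MatUnitary C} (h : u ≈ u') (h' : v ≈ v') :
    u.mul v ≈ u'.mul v' := by
  obtain ⟨N, hu, hu', h⟩ := h
  obtain ⟨M, hv, hv', h'⟩ := h'
  have a := joined_pad (le_max_left N M) h
  have b := joined_pad (le_max_right N M) h'
  rw [pad_pad, pad_pad] at a b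
  have h1 : (u.mul v).1 ≤ max N M := max_le_max hu hv
  have h2 : (u'.mul v').1 ≤ max N M := max_le_max hu' hv'
  refine MatUnitary.equiv_of_joined h1 h2 ?_
  rw [MatUnitary.pad_mul, MatUnitary.pad_mul]
  exact a.mul b

lemma MatUnitary.mul_assoc (u v w : MatUnitary C) :
    (u.mul v).mul w ≈ u.mul (v.mul w) := by
  have h1 : ((u.mul v).mul w).1 ≤ max (max u.1 v.1) w.1 := le_rfl
  have h2 : (u.mul (v.mul w)).1 ≤ max (max u.1 v.1) w.1 := (max_assoc _ _ _).ge
  refine MatUnitary.equiv_of_joined h1 h2 ?_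
  rw [MatUnitary.pad_mul, MatUnitary.pad_mul, MatUnitary.pad_mul, MatUnitary.pad_mul,
    _root_.mul_assoc]

/-- A skew-adjoint square root `J` of `-1` is joined to `1` by `cos t + (sin t) J`. -/
lemma joined_one_of_skew {R : Type*} [Ring R] [StarRing R] [Algebra ℝ R] [StarModule ℝ R]
    [TopologicalSpace R] [ContinuousAdd R] [ContinuousSMul ℝ R] (J : unitary R)
    (h1 : star (J : R) = -J) : Joined (1 : unitary R) J := by
  have h2 : (J : R) * J = -1 := by
    have := Unitary.coe_star_mul_self J
    rw [h1, neg_mul] at this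
    rw [← this, neg_neg]
  have hs (t : ℝ) : star (Real.cos t • (1 : R) + Real.sin t • (J : R)) =
      Real.cos t • (1 : R) - Real.sin t • (J : R) := by
    simp [h1, sub_eq_add_neg]
  have hcs (t : ℝ) : (Real.cos t * Real.cos t) • (1 : R) + (Real.sin t * Real.sin t) • (1 : R)
      = 1 := by
    rw [← add_smul, ← sq, ← sq, Real.cos_sq_add_sin_sq, one_smul]
  let φ : ℝ → unitary R := fun t => ⟨Real.cos t • (1 : R) + Real.sin t • (J : R), by
    rw [Unitary.mem_iff, hs]
    constructor
    · nth_rewrite 3 [← hcs t]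
      simp only [sub_mul, mul_add, smul_mul_smul_comm, one_mul, mul_one, h2, smul_neg]
      rw [mul_comm (Real.sin t) (Real.cos t)]
      abel
    · nth_rewrite 3 [← hcs t]
      simp only [add_mul, mul_sub, smul_mul_smul_comm, one_mul, mul_one, h2, smul_neg]
      rw [mul_comm (Real.sin t) (Real.cos t)]
      abel⟩
  have hφ : Continuous φ := by
    refine Continuous.subtype_mk ?_ _
    exact (Real.continuous_cos.smul continuous_const).add
      (Real.continuous_sin.smul continuous_const)
  have h := (PathConnectedSpace.joined (0 : ℝ) (Real.pi / 2)).map hφ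
  have e0 : φ 0 = 1 := Subtype.ext (by simp [φ])
  have e1 : φ (Real.pi / 2) = J := Subtype.ext (by simp [φ])
  rwa [e0, e1] at h

/-- `diag(uv, 1)` and `diag(vu, 1)` are homotopic when there is room for a second block. -/
lemma joined_corner_comm {ι μ : Type*} [Fintype ι] [Fintype μ] [DecidableEq ι] [DecidableEq μ]
    (e : ι ⊕ ι ≃ μ) (u v : unitary (Matrix ι ι C)) :
    Joined (corner e (u * v)) (corner e (v * u)) := by
  let W : unitary (Matrix μ μ C) := ⟨Matrix.reindex e e (Matrix.fromBlocks 0 (-1) 1 0), by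
    rw [Unitary.mem_iff, Matrix.star_eq_conjTranspose, Matrix.conjTranspose_reindex]
    simp only [Matrix.reindex_apply, Matrix.submatrix_mul_equiv,
      Matrix.fromBlocks_conjTranspose, Matrix.fromBlocks_multiply]
    simp⟩
  have hW : Joined (1 : unitary (Matrix μ μ C)) W := by
    apply joined_one_of_skew
    simp only [W]
    rw [Matrix.star_eq_conjTranspose, Matrix.conjTranspose_reindex,
      Matrix.fromBlocks_conjTranspose]
    simp only [Matrix.reindex_apply]
    ext i j
    obtain ⟨a, rfl⟩ := e.surjective i
    obtain ⟨b, rfl⟩ := e.surjective j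
    rcases a with a | a <;> rcases b with b | b <;> simp
  have hc : corner e u * (W * corner e v * W⁻¹) = (W * corner e v * W⁻¹) * corner e u := by
    have hWi : ((W⁻¹ : unitary (Matrix μ μ C)) : Matrix μ μ C) =
        Matrix.reindex e e (Matrix.fromBlocks 0 1 (-1) 0) := by
      change (Matrix.reindex e e (Matrix.fromBlocks 0 (-1) 1 0))ᴴ = _
      rw [Matrix.conjTranspose_reindex, Matrix.fromBlocks_conjTranspose]
      simp
    apply Subtype.ext
    simp only [Submonoid.coe_mul, hWi]
    simp only [W, corner, MonoidHom.coe_mk, OneHom.coe_mk, Matrix.reindex_apply,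
      Matrix.submatrix_mul_equiv, Matrix.fromBlocks_multiply]
    simp
  have hconj : Joined (corner e v) (W * corner e v * W⁻¹) := by
    have := (hW.mul (Joined.refl (corner e v))).mul hW.inv
    simpa using this
  have a := (Joined.refl (corner e u)).mul hconj
  have b := hconj.mul (Joined.refl (corner e u))
  rw [map_mul, map_mul]
  rw [hc] at a
  exact a.trans b.symm

lemma MatUnitary.comm_aux {n : ℕ} (u v : UMat C n) :
    (⟨n, u * v⟩ : MatUnitary C) ≈ ⟨n, v * u⟩ := by
  have hn : n ≤ n + n := Nat.le_add_right n n
  refine MatUnitary.equiv_of_joined hn hn ?_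
  have key (w : UMat C n) : pad hn w = corner (finSumFinEquiv (m := n) (n := n)) w := by
    apply Subtype.ext
    ext i j
    rw [pad_apply]
    obtain ⟨a, rfl⟩ := (finSumFinEquiv (m := n) (n := n)).surjective i
    obtain ⟨b, rfl⟩ := (finSumFinEquiv (m := n) (n := n)).surjective j
    have hr : (corner (finSumFinEquiv (m := n) (n := n)) w : Matrix (Fin (n + n)) (Fin (n + n)) C)
        (finSumFinEquiv a) (finSumFinEquiv b) =
        Matrix.fromBlocks (w : Matrix (Fin n) (Fin n) C) 0 0 1 a b := by
      simp [corner]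
    rw [hr]
    rcases a with a | a <;> rcases b with b | b
    · simp
    · simp [Fin.ext_iff]
      omega
    · simp [Fin.ext_iff]
      omega
    · simp [Matrix.one_apply]
  simp only [key]
  exact joined_corner_comm _ u v

lemma MatUnitary.mul_comm (u v : MatUnitary C) : u.mul v ≈ v.mul u := by
  have h1 : (u.mul v).1 ≤ max u.1 v.1 := le_rfl
  have h2 : (v.mul u).1 ≤ max u.1 v.1 := (max_comm _ _).le
  have e1 := Setoid.symm (MatUnitary.pad_equiv h1 (u.mul v).2)
  have e2 := MatUnitary.pad_equiv h2 (v.mul u).2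
  rw [MatUnitary.pad_mul] at e1 e2
  exact Setoid.trans (Setoid.trans e1 (MatUnitary.comm_aux _ _)) e2

variable (C) in
/-- `K₁(C)` for a unital C⋆-algebra `C`: stable homotopy classes of unitary matrices over `C`,
that is, the quotient of `U_∞(C) = ⋃ U(M_n(C))` by its path component of `1`. -/
def K1 : Type v := Quotient (matUnitarySetoid C)

lemma MatUnitary.mul_equiv {u v w : MatUnitary C} {N : ℕ} (hu : u.1 ≤ N) (hv : v.1 ≤ N)
    (hw : w.1 ≤ N) (h : pad hu u.2 * pad hv v.2 = pad hw w.2) : u.mul v ≈ w := by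
  have huv : (u.mul v).1 ≤ N := max_le hu hv
  refine MatUnitary.equiv_of_joined huv hw ?_
  rw [MatUnitary.pad_mul, h]

/-- Addition in `K₁(C)`: `[u] + [v] = [uv]`, after stabilizing to a common size. -/
instance : Add (K1 C) :=
  ⟨Quotient.map₂ MatUnitary.mul fun _ _ h _ _ h' => MatUnitary.mul_congr h h'⟩

/-- The zero of `K₁(C)`: the class of the unitaries `1`. -/
instance : Zero (K1 C) := ⟨Quotient.mk _ ⟨0, 1⟩⟩

/-- Negation in `K₁(C)`: `-[u] = [u⋆]`. -/
instance : Neg (K1 C) :=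
  ⟨Quotient.map (fun u => ⟨u.1, u.2⁻¹⟩) (by
    rintro u v ⟨N, hu, hv, h⟩
    refine ⟨N, hu, hv, ?_⟩
    rw [map_inv, map_inv]
    exact h.inv)⟩

instance : AddCommGroup (K1 C) where
  add_assoc := by
    rintro ⟨u⟩ ⟨v⟩ ⟨w⟩
    exact Quotient.sound (MatUnitary.mul_assoc u v w)
  add_comm := by
    rintro ⟨u⟩ ⟨v⟩
    exact Quotient.sound (MatUnitary.mul_comm u v)
  zero_add := by
    rintro ⟨u⟩
    exact Quotient.sound (MatUnitary.mul_equiv (N := u.1) (Nat.zero_le _) le_rfl le_rfl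
      (by rw [map_one, one_mul]))
  add_zero := by
    rintro ⟨u⟩
    exact Quotient.sound (MatUnitary.mul_equiv (N := u.1) le_rfl (Nat.zero_le _) le_rfl
      (by rw [map_one, mul_one]))
  neg_add_cancel := by
    rintro ⟨u⟩
    exact Quotient.sound (MatUnitary.mul_equiv (u := ⟨u.1, u.2⁻¹⟩) (N := u.1) le_rfl le_rfl
      (Nat.zero_le _) (by rw [map_one, map_inv, inv_mul_cancel]))
  nsmul := nsmulRec
  zsmul := zsmulRec

/-- The class `[u] ∈ K₁(C)` of a unitary matrix `u ∈ U(M_n(C))`. -/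
def K1.mk {n : ℕ} (u : UMat C n) : K1 C := Quotient.mk _ ⟨n, u⟩

/-- The class `[u] ∈ K₁(C)` of a unitary `u ∈ U(C)`, viewed as a `1 × 1` matrix. -/
def K1.ofUnitary (u : unitary C) : K1 C :=
  K1.mk (n := 1) ⟨Matrix.diagonal fun _ => (u : C), by
    rw [Unitary.mem_iff, Matrix.star_eq_conjTranspose, Matrix.diagonal_conjTranspose]
    simp [Pi.star_def]⟩

/-- The image of a subgroup `G ⊆ U(C)` in `K₁(C)`. -/
def imageK1 (G : Subgroup (unitary C)) : Set (K1 C) := K1.ofUnitary '' (G : Set (unitary C))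

end KOne

/-! ## Strong unitary equivalence and the groups `H_u(G, F)` -/

/-- `H_u(G, F) = {x ∈ F : φ(u) = x for some homomorphism φ : G → F}`. -/
def H {G : Type*} [AddCommGroup G] (g : G) (F : Type*) [AddCommGroup F] : Set F :=
  {x | ∃ φ : G →+ F, φ g = x}

/-- The inner automorphism `ad u : x ↦ u⋆ x u`. -/
def ad {C : Type*} [CStarAlgebra C] (u : unitary C) (x : C) : C := star (u : C) * x * (u : C)

/-- `φ₁` and `φ₂` are `G`-strongly unitarily equivalent: `ad u ∘ φ₁ = φ₂` for some `u ∈ G`. -/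
def GStronglyUnitarilyEquivalent {A C : Type*} [NonUnitalCStarAlgebra A] [CStarAlgebra C]
    (G : Subgroup (unitary C)) (φ₁ φ₂ : A →⋆ₙₐ[ℂ] C) : Prop :=
  ∃ u ∈ G, ∀ a, ad u (φ₁ a) = φ₂ a

end

end CStarKTheory

/-! If `ad w ∘ h₁ = ad u ∘ h₁` with `w ∈ G`, then `z = u w⁻¹` commutes with `h₁(A)`, and `[u] = [z]
+ [w]`. It remains to realise `[z]` as the value at `[1_A]` of a homomorphism `K₀(A) → K₁(C)`. Such
a homomorphism is `[p] ↦ [h₁(p)z + (1 - h₁(p))]`: since `z` commutes with `h₁(p)`, this element is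
unitary, and at `p = 1` it equals `z`.

Invariance under Murray-von Neumann equivalence (`K1.mk_pairingUnitary_congr`) rests on
`exists_mul_corner_cutDown_eq`: a partial isometry `v` from `p` to `q` yields a self-adjoint unitary
that swaps their supports and conjugates one cut-down unitary into the other. Additivity
(`K1.mk_pairingUnitary_sum`) holds because the cut-down by `diag(p, q)` is a product of two
commuting blocks. The universal property of the Grothendieck group then gives the map on `K₀(A)`. -/

namespace CStarKTheory

noncomputable section

universe v

/-! ### Products, conjugation and corner embeddings in `K₁`. -/

section Corner

variable {C : Type v} [CStarAlgebra C]

lemma K1.mk_mul {n : ℕ} (x y : UMat C n) : K1.mk (x * y) = K1.mk x + K1.mk y := by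
  refine (Quotient.sound (MatUnitary.mul_equiv (u := ⟨n, x⟩) (v := ⟨n, y⟩) (w := ⟨n, x * y⟩)
    (N := n) le_rfl le_rfl le_rfl ?_)).symm
  simp only [pad_self]

/-- Conjugate unitaries have the same class because `K₁` is abelian; the form without inverses suits
block-matrix identities. -/
lemma K1.mk_eq_of_mul_eq_mul {n : ℕ} {x y w : UMat C n} (h : w * x = y * w) :
    K1.mk x = K1.mk y := by
  have := congrArg K1.mk h
  rw [K1.mk_mul, K1.mk_mul, add_comm] at this
  exact add_right_cancel this

lemma K1.mk_pad {n N : ℕ} (h : n ≤ N) (x : UMat C n) : K1.mk (pad h x) = K1.mk x :=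
  Quotient.sound (MatUnitary.pad_equiv h x)

lemma K1.ofUnitary_mul (x y : unitary C) :
    K1.ofUnitary (x * y) = K1.ofUnitary x + K1.ofUnitary y := by
  unfold K1.ofUnitary
  rw [← K1.mk_mul]
  congr 1
  apply Subtype.ext
  simp [Matrix.diagonal_mul_diagonal]

/-- The class in `K₁` of a corner embedding does not depend on the position of the corner. -/
lemma K1.mk_corner {n N : ℕ} {κ : Type*} [Fintype κ] [DecidableEq κ] (e : Fin n ⊕ κ ≃ Fin N)
    (x : UMat C n) : K1.mk (corner e x) = K1.mk x := by
  have hcard : n + Fintype.card κ = N := by simpa using Fintype.card_congr e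
  have hn : n ≤ N := by omega
  let f : κ ≃ Fin (N - n) := Fintype.equivFinOfCardEq (by omega)
  -- `s` carries the position chosen by `e` to the standard top-left position; its permutation
  -- matrix `P` conjugates one embedding into the other.
  let s : Fin N ≃ Fin N := e.symm.trans (((Equiv.refl _).sumCongr f).trans (padEquiv hn))
  let P : UMat C N := ⟨(1 : Matrix (Fin N) (Fin N) C).submatrix s id, by
    rw [Unitary.mem_iff, Matrix.star_eq_conjTranspose, Matrix.conjTranspose_submatrix,
      Matrix.conjTranspose_one]
    constructor
    · rw [Matrix.submatrix_mul_equiv, one_mul, Matrix.submatrix_id_id]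
    · have := Matrix.submatrix_mul_equiv (1 : Matrix (Fin N) (Fin N) C) 1 s (Equiv.refl _) s
      simpa using this⟩
  have key : P * pad hn x = corner e x * P := by
    have hs : (corner e x : Matrix (Fin N) (Fin N) C) =
        (pad hn x : Matrix (Fin N) (Fin N) C).submatrix s s := by
      ext i j
      obtain ⟨a, rfl⟩ := e.surjective i
      obtain ⟨b, rfl⟩ := e.surjective j
      rcases a with a | a <;> rcases b with b | b <;>
        simp [corner, pad, s, Matrix.one_apply]
    apply Subtype.ext
    simp only [Submonoid.coe_mul, hs, P]
    have h1 := Matrix.submatrix_mul_equiv (1 : Matrix (Fin N) (Fin N) C)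
      (pad hn x : Matrix (Fin N) (Fin N) C) s (Equiv.refl _) id
    rw [Matrix.submatrix_mul_equiv]
    simpa using h1
  rw [← K1.mk_eq_of_mul_eq_mul key, K1.mk_pad]

/-- Expresses a lower-right corner through the same `e` as the upper-left one, so that both enter a
single block computation. -/
lemma coe_corner_sumComm {ι κ μ : Type*} [Fintype ι] [Fintype κ] [Fintype μ] [DecidableEq ι]
    [DecidableEq κ] [DecidableEq μ] (e : ι ⊕ κ ≃ μ) (x : unitary (Matrix κ κ C)) :
    (corner ((Equiv.sumComm κ ι).trans e) x : Matrix μ μ C) =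
      Matrix.reindex e e (Matrix.fromBlocks 1 0 0 (x : Matrix κ κ C)) := by
  ext i j
  obtain ⟨a, rfl⟩ := e.surjective i
  obtain ⟨b, rfl⟩ := e.surjective j
  rcases a with a | a <;> rcases b with b | b <;> simp [corner]

end Corner

/-! ### Cutting a unitary down by a commuting projection. -/

section CutDown

/-- The unitary `pz + (1 - p)` for a projection `p` commuting with a unitary `z`. -/
def cutDown {R : Type*} [Ring R] [StarRing R] (p : R) (hp : IsStarProjection p) (z : unitary R)
    (hc : Commute p (z : R)) : unitary R :=
  ⟨1 + p * ((z : R) - 1), by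
    have h1 : star p = p := hp.isSelfAdjoint
    have h2 : p * p = p := hp.isIdempotentElem
    have h3 : star (z : R) * (z : R) = 1 := Unitary.coe_star_mul_self z
    have h4 : (z : R) * star (z : R) = 1 := Unitary.coe_mul_star_self z
    have h5 : p * z = z * p := hc
    have h6 : p * star (z : R) = star (z : R) * p := by
      have := congrArg star h5
      rw [star_mul, star_mul, h1] at this
      exact this.symm
    rw [Unitary.mem_iff]
    simp only [star_add, star_mul, star_sub, star_one, h1]
    constructor
    -- The product of the two deviations from `1`. Once `star z * z = 1`, it becomes `p (2 - star z
    -- - z)`, which cancels the two linear terms.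
    · have : (star (z : R) - 1) * p * (p * (z - 1)) =
          p * (star (z : R) * z - star (z : R) - z + 1) := by
        rw [mul_assoc, ← mul_assoc p p, h2, ← mul_assoc, sub_mul, one_mul, ← h6]
        noncomm_ring
      rw [add_mul, mul_add, mul_add, one_mul, one_mul, mul_one, this, h3, sub_mul, ← h6]
      noncomm_ring
    · have : p * (z - 1) * ((star (z : R) - 1) * p) =
          (z * star (z : R) - star (z : R) - z + 1) * p := by
        rw [mul_sub, mul_one, h5, show (z : R) * p - p = (z - 1) * p by rw [sub_mul, one_mul],
          sub_mul (star (z : R)), one_mul, ← h6,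
          show p * star (z : R) - p = p * (star (z : R) - 1) by rw [mul_sub, mul_one],
          mul_assoc, ← mul_assoc p p, h2, mul_sub p, h6]
        noncomm_ring
      rw [add_mul, mul_add, mul_add, one_mul, one_mul, mul_one, this, h4, mul_sub, h5]
      noncomm_ring⟩

end CutDown

/-! ### The pairing of `K₀(A)` with a unitary commuting with the image of `A`. -/

section Pairing

variable {C : Type v} [CStarAlgebra C]

/-- The scalar matrix `diag(z, …, z)` of a unitary. -/
def scalarUnitary (ι : Type*) [Fintype ι] [DecidableEq ι] (z : unitary C) :
    unitary (Matrix ι ι C) :=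
  ⟨Matrix.diagonal fun _ => (z : C), by
    rw [Unitary.mem_iff, Matrix.star_eq_conjTranspose, Matrix.diagonal_conjTranspose]
    simp [Pi.star_def]⟩

/-- A partial isometry between projections can be chosen to be supported on them. -/
lemma MvN.exists_supported {A : Type*} [CStarAlgebra A] {ι κ : Type*} [Fintype ι] [Fintype κ]
    {p : Matrix ι ι A} {q : Matrix κ κ A} (hp : IsStarProjection p) (hq : IsStarProjection q)
    (h : MvN p q) : ∃ v : Matrix κ ι A, vᴴ * v = p ∧ v * vᴴ = q ∧ v * p = v := by
  obtain ⟨v, h1, h2⟩ := h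
  have h3 : pᴴ = p := hp.isSelfAdjoint
  have h4 : p * p = p := hp.isIdempotentElem
  have h5 : q * q = q := hq.isIdempotentElem
  -- Both sides are `v v⋆ v`. Replacing `v` by `v p` secures the support condition by algebra alone,
  -- without the C⋆-identity.
  have h6 : v * p = q * v := by rw [← h1, ← h2, Matrix.mul_assoc]
  refine ⟨v * p, ?_, ?_, ?_⟩
  · rw [Matrix.conjTranspose_mul, h3, Matrix.mul_assoc, ← Matrix.mul_assoc vᴴ, h1, h4, h4]
  · rw [Matrix.conjTranspose_mul, h3, Matrix.mul_assoc, ← Matrix.mul_assoc p, h4,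
      ← Matrix.mul_assoc, h6, Matrix.mul_assoc, h2, h5]
  · rw [Matrix.mul_assoc, h4]

/-- The symmetry exchanging the supports of a partial isometry. -/
def exchange {ι κ : Type*} [DecidableEq ι] [DecidableEq κ] [Fintype ι] [Fintype κ]
    (v : Matrix κ ι C) : Matrix (ι ⊕ κ) (ι ⊕ κ) C :=
  Matrix.fromBlocks (1 - vᴴ * v) vᴴ v (1 - v * vᴴ)

section Exchange

variable {ι κ : Type*} [DecidableEq ι] [DecidableEq κ] [Fintype ι] [Fintype κ]
  {v : Matrix κ ι C}

lemma conjTranspose_exchange : (exchange v)ᴴ = exchange v := by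
  simp [exchange, Matrix.fromBlocks_conjTranspose]

/-- Together with self-adjointness this makes `exchange v` unitary; `hv` says that `v` is a partial
isometry. -/
lemma exchange_mul_self (hv : v * (vᴴ * v) = v) : exchange v * exchange v = 1 := by
  have hv' : vᴴ * (v * vᴴ) = vᴴ := by
    simpa [Matrix.mul_assoc] using congrArg Matrix.conjTranspose hv
  rw [exchange, Matrix.fromBlocks_multiply, ← Matrix.fromBlocks_one]
  congr 1 <;> simp [Matrix.mul_sub, Matrix.sub_mul, Matrix.mul_assoc, hv, hv']

/-- `exchange v` swaps the ranges of `v⋆v` and `vv⋆` and fixes their complements, where both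
cut-downs are trivial. On the supports, `hzy` says that `v` carries `z` to `y`. -/
lemma exchange_mul_fromBlocks (hv : v * (vᴴ * v) = v) {z : Matrix ι ι C} {y : Matrix κ κ C}
    (hzy : v * z = y * v) (hy : v * vᴴ * y = y * (v * vᴴ)) :
    exchange v * Matrix.fromBlocks (1 + vᴴ * v * (z - 1)) 0 0 1 =
      Matrix.fromBlocks 1 0 0 (1 + v * vᴴ * (y - 1)) * exchange v := by
  have hv' : vᴴ * (v * vᴴ) = vᴴ := by
    simpa [Matrix.mul_assoc] using congrArg Matrix.conjTranspose hv
  have hv₂ (x : Matrix ι ι C) : v * (vᴴ * (v * x)) = v * x := by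
    rw [← Matrix.mul_assoc vᴴ, ← Matrix.mul_assoc, hv]
  rw [exchange, Matrix.fromBlocks_multiply, Matrix.fromBlocks_multiply]
  congr 1
  · simp [Matrix.mul_sub, Matrix.sub_mul, Matrix.mul_add, Matrix.mul_assoc, hv₂, hv]
  · simp
  · simp [Matrix.mul_sub, Matrix.sub_mul, Matrix.mul_add, Matrix.add_mul, Matrix.mul_assoc,
      hv₂, hv, ← hzy]
  · have hy' : v * (vᴴ * y) = y * (v * vᴴ) := by rw [← Matrix.mul_assoc, hy]
    simp [Matrix.mul_sub, Matrix.sub_mul, Matrix.add_mul, Matrix.mul_assoc, hy', hv']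
    abel

end Exchange

/-- Cut-downs by equivalent projections are conjugate in a common corner. -/
lemma exists_mul_corner_cutDown_eq {ι κ μ : Type*} [Fintype ι] [Fintype κ] [Fintype μ]
    [DecidableEq ι] [DecidableEq κ] [DecidableEq μ] (e : ι ⊕ κ ≃ μ)
    {p : Matrix ι ι C} {q : Matrix κ κ C} (hp : IsStarProjection p) (hq : IsStarProjection q)
    {z : unitary (Matrix ι ι C)} {y : unitary (Matrix κ κ C)}
    (hpz : Commute p (z : Matrix ι ι C)) (hqy : Commute q (y : Matrix κ κ C)) {v : Matrix κ ι C}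
    (h1 : vᴴ * v = p) (h2 : v * vᴴ = q) (h3 : v * p = v)
    (hv : v * (z : Matrix ι ι C) = (y : Matrix κ κ C) * v) :
    ∃ w : unitary (Matrix μ μ C), w * corner e (cutDown p hp z hpz) =
      corner ((Equiv.sumComm κ ι).trans e) (cutDown q hq y hqy) * w := by
  subst h1 h2
  refine ⟨⟨(exchange v).submatrix e.symm e.symm, ?_⟩, Subtype.ext ?_⟩
  · rw [Unitary.mem_iff, Matrix.star_eq_conjTranspose, Matrix.conjTranspose_submatrix,
      conjTranspose_exchange, Matrix.submatrix_mul_equiv, exchange_mul_self h3,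
      Matrix.submatrix_one_equiv]
    exact ⟨rfl, rfl⟩
  · have h := congrArg (fun B => B.submatrix e.symm e.symm)
      (exchange_mul_fromBlocks h3 hv hqy.eq)
    simp only [← Matrix.submatrix_mul_equiv _ _ _ e.symm] at h
    rw [Submonoid.coe_mul, Submonoid.coe_mul, coe_corner_sumComm]
    exact h

/-- Cut-downs by equivalent projections have the same class in `K₁`. -/
lemma K1.mk_cutDown_eq {m n : ℕ} {p : Matrix (Fin m) (Fin m) C} {q : Matrix (Fin n) (Fin n) C}
    (hp : IsStarProjection p) (hq : IsStarProjection q) {z : UMat C m} {y : UMat C n}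
    (hpz : Commute p (z : Matrix (Fin m) (Fin m) C))
    (hqy : Commute q (y : Matrix (Fin n) (Fin n) C)) {v : Matrix (Fin n) (Fin m) C}
    (h1 : vᴴ * v = p) (h2 : v * vᴴ = q) (h3 : v * p = v)
    (hv : v * (z : Matrix (Fin m) (Fin m) C) = (y : Matrix (Fin n) (Fin n) C) * v) :
    K1.mk (cutDown p hp z hpz) = K1.mk (cutDown q hq y hqy) := by
  obtain ⟨w, hw⟩ := exists_mul_corner_cutDown_eq finSumFinEquiv hp hq hpz hqy h1 h2 h3 hv
  have h := K1.mk_eq_of_mul_eq_mul hw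
  -- The two corners occupy complementary blocks, but position does not affect the class.
  rwa [K1.mk_corner, K1.mk_corner] at h

variable {A : Type*} [CStarAlgebra A]

lemma isStarProjection_map (h : A →⋆ₙₐ[ℂ] C) {ι : Type*} [Fintype ι] {p : Matrix ι ι A}
    (hp : IsStarProjection p) : IsStarProjection (p.map h) := by
  have h1 : pᴴ = p := hp.isSelfAdjoint
  have h2 : p * p = p := hp.isIdempotentElem
  refine ⟨?_, ?_⟩
  · rw [IsIdempotentElem, ← Matrix.map_mul, h2]
  · rw [IsSelfAdjoint, Matrix.star_eq_conjTranspose,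
      ← Matrix.conjTranspose_map _ (fun a => (map_star h a)), h1]

/-- For square `v` this is the commutation that cut-downs need; the rectangular case supplies the
intertwining condition for a partial isometry over `A`. -/
lemma map_mul_scalarUnitary (h : A →⋆ₙₐ[ℂ] C) {z : unitary C}
    (hz : ∀ a, Commute (h a) (z : C)) {ι κ : Type*} [Fintype ι] [Fintype κ] [DecidableEq ι]
    [DecidableEq κ] (v : Matrix κ ι A) :
    v.map h * (scalarUnitary ι z : Matrix ι ι C) = (scalarUnitary κ z : Matrix κ κ C) * v.map h := by
  ext i j
  simp [scalarUnitary, (hz (v i j)).eq]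

/-- The unitary `h(p)z + (1 - h(p))` of a projection `p` over `A`, for a unitary `z` commuting
with the image of `h`. -/
def pairingUnitary (h : A →⋆ₙₐ[ℂ] C) (z : unitary C) (hz : ∀ a, Commute (h a) (z : C))
    (p : MatProj A) : UMat C p.1 :=
  cutDown (p.2.1.map h) (isStarProjection_map h p.2.2) (scalarUnitary (Fin p.1) z)
    (map_mul_scalarUnitary h hz p.2.1)

lemma pairingUnitary_apply (h : A →⋆ₙₐ[ℂ] C) (z : unitary C) (hz : ∀ a, Commute (h a) (z : C))
    (p : MatProj A) (i j : Fin p.1) :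
    (pairingUnitary h z hz p : Matrix (Fin p.1) (Fin p.1) C) i j =
      (if i = j then 1 else 0) + h (p.2.1 i j) * ((z : C) - 1) := by
  simp [pairingUnitary, cutDown, scalarUnitary, Matrix.one_apply, mul_sub, Matrix.sub_apply]

/-- The partial isometry over `A` is pushed forward by `h`; its image intertwines the scalar
matrices of `z` of the two sizes. -/
lemma K1.mk_pairingUnitary_congr (h : A →⋆ₙₐ[ℂ] C) (z : unitary C)
    (hz : ∀ a, Commute (h a) (z : C)) {p q : MatProj A} (hpq : p ≈ q) :
    K1.mk (pairingUnitary h z hz p) = K1.mk (pairingUnitary h z hz q) := by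
  obtain ⟨v, h1, h2, h3⟩ := MvN.exists_supported p.2.2 q.2.2 hpq
  have hs : (v.map h)ᴴ = vᴴ.map h :=
    (Matrix.conjTranspose_map _ (fun a => (map_star h a))).symm
  refine K1.mk_cutDown_eq _ _ _ _ (v := v.map h) ?_ ?_ ?_ (map_mul_scalarUnitary h hz v)
  · rw [hs, ← Matrix.map_mul, h1]
  · rw [hs, ← Matrix.map_mul, h2]
  · rw [← Matrix.map_mul, h3]

/-- The cut-down by `diag(p, q)` is block diagonal, hence the product of the two cut-downs placed in
complementary corners by `e` and `f`. -/
lemma K1.mk_pairingUnitary_sum (h : A →⋆ₙₐ[ℂ] C) (z : unitary C)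
    (hz : ∀ a, Commute (h a) (z : C)) (p q : MatProj A) :
    K1.mk (pairingUnitary h z hz (p.sum q)) =
      K1.mk (pairingUnitary h z hz p) + K1.mk (pairingUnitary h z hz q) := by
  let e : Fin p.1 ⊕ Fin q.1 ≃ Fin (p.1 + q.1) := finSumFinEquiv
  let f : Fin q.1 ⊕ Fin p.1 ≃ Fin (p.1 + q.1) := (Equiv.sumComm _ _).trans finSumFinEquiv
  have key : (pairingUnitary h z hz (p.sum q) : UMat C (p.1 + q.1)) =
      corner e (pairingUnitary h z hz p) * corner f (pairingUnitary h z hz q) := by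
    apply Subtype.ext
    rw [Submonoid.coe_mul, coe_corner_sumComm]
    simp only [corner, MonoidHom.coe_mk, OneHom.coe_mk, Matrix.reindex_apply]
    ext i j
    obtain ⟨a, rfl⟩ := e.surjective i
    obtain ⟨b, rfl⟩ := e.surjective j
    refine (pairingUnitary_apply h z hz (p.sum q) _ _).trans ?_
    rcases a with a | a <;> rcases b with b | b <;>
      simp [MatProj.sum, blockSum, e, pairingUnitary_apply, Fin.ext_iff,
        Matrix.fromBlocks_multiply]
    all_goals omega
  rw [← K1.mk_corner e (pairingUnitary h z hz p), ← K1.mk_corner f (pairingUnitary h z hz q),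
    ← K1.mk_mul, ← key]
  rfl

/-- The homomorphism `V(A) → K₁(C)`, `[p] ↦ [h(p)z + (1 - h(p))]`. -/
def pairingV (h : A →⋆ₙₐ[ℂ] C) (z : unitary C) (hz : ∀ a, Commute (h a) (z : C)) :
    V A →+ K1 C :=
  AddMonoidHom.mk' (M := V A) (G := K1 C)
    (Quotient.lift (fun p : MatProj A => K1.mk (pairingUnitary h z hz p))
      fun _ _ hpq => K1.mk_pairingUnitary_congr h z hz hpq)
    (by
      rintro ⟨p⟩ ⟨q⟩
      exact K1.mk_pairingUnitary_sum h z hz p q)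

/-- The witness is the extension of `pairingV` to `K₀(A)`. Since `h 1 = 1`, the cut-down at the unit
is `1 + (z - 1) = z`. -/
lemma ofUnitary_mem_H (h : A →⋆ₙₐ[ℂ] C) (h_one : h 1 = 1) (z : unitary C)
    (hz : ∀ a, Commute (h a) (z : C)) : K1.ofUnitary z ∈ H (K0.unitClass A) (K1 C) := by
  refine ⟨Algebra.GrothendieckAddGroup.lift (pairingV h z hz), ?_⟩
  have h1 : Algebra.GrothendieckAddGroup.lift (pairingV h z hz) (K0.unitClass A) =
      pairingV h z hz (V.mk (1 : Matrix (Fin 1) (Fin 1) A) (IsStarProjection.one _)) :=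
    DFunLike.congr_fun (Algebra.GrothendieckAddGroup.lift.symm_apply_apply (pairingV h z hz)) _
  rw [h1]
  change K1.mk (pairingUnitary h z hz ⟨1, 1, IsStarProjection.one _⟩) = _
  unfold K1.ofUnitary
  congr 1
  apply Subtype.ext
  simp [pairingUnitary, cutDown, scalarUnitary, Matrix.map_one h (map_zero h) h_one]

end Pairing

end

end CStarKTheory

theorem proposition3p4 {A : Type*} {C : Type*} [CStarAlgebra A] [TopologicalSpace.SeparableSpace A]
    [CStarAlgebra C] (G : Subgroup (unitary C)) (hG : G.Normal) (h₁ h₂ : A →⋆ₙₐ[ℂ] C)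
    (hinj₁ : Function.Injective h₁) (hinj₂ : Function.Injective h₂) (hunital : h₁ 1 = 1)
    (u : unitary C) (had : ∀ a, h₂ a = CStarKTheory.ad u (h₁ a))
    (hequiv : CStarKTheory.GStronglyUnitarilyEquivalent G h₁ h₂) :
    CStarKTheory.K1.ofUnitary u ∈
      CStarKTheory.H (CStarKTheory.K0.unitClass A) (CStarKTheory.K1 C) +
        CStarKTheory.imageK1 G := by
  obtain ⟨w, hw, hwad⟩ := hequiv
  -- From `w⋆ h₁(a) w = u⋆ h₁(a) u`, multiply by `u` on the left and by `w⋆` on the right.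
  have hz (a : A) : Commute (h₁ a) ((u * w⁻¹ : unitary C) : C) := by
    have h : star (w : C) * h₁ a * w = star (u : C) * h₁ a * u := (hwad a).trans (had a)
    have hu : (u : C) * star (u : C) = 1 := Unitary.coe_mul_star_self u
    have hw' : (w : C) * star (w : C) = 1 := Unitary.coe_mul_star_self w
    change h₁ a * ((u : C) * star (w : C)) = (u : C) * star (w : C) * h₁ a
    calc h₁ a * ((u : C) * star (w : C))
        = (u : C) * (star (u : C) * h₁ a * u) * star (w : C) := by
          simp only [← mul_assoc, hu, one_mul]
      _ = (u : C) * star (w : C) * h₁ a := by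
          rw [← h]
          simp only [mul_assoc, hw', mul_one]
  refine ⟨_, CStarKTheory.ofUnitary_mem_H h₁ hunital (u * w⁻¹) hz, _, ⟨w, hw, rfl⟩, ?_⟩
  change CStarKTheory.K1.ofUnitary (u * w⁻¹) + CStarKTheory.K1.ofUnitary w = _
  rw [← CStarKTheory.K1.ofUnitary_mul, inv_mul_cancel_right]
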